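/- Let $G$ be a finite connected directed graph, possibly with multiple edges but without looped edges, with fundamental group $\pi$ and universal covering $\widetilde G\to G$; elements of $\pi$ are identified with covering transformations of $\widetilde G$. Let $f:G\to G$ be a continuous map that permutes the vertices and is homotopic to the identity, and let $\widetilde f:\widetilde G\to\widetilde G$ be the lift of $f$ obtained by lifting a homotopy from the identity to $f$, starting at the identity of $\widetilde G$. Let $E$ be an edge of $G$ with initial vertex $V_1$ and terminal vertex $V_2$, and let $\mathcal T$ be a spanning tree of $G$ containing $E$. Fix a coherent labeling of $\widetilde G$: a lift of $\mathcal T$ to $\widetilde G$ gives the chosen lifts $\widetilde V$ of the vertices $V$ and $\widetilde E'$ of the edges $E'\in\mathcal T$; for an edge $E'\notin\mathcal T$ from $V$ to $V'$, $\widetilde E'$ is the lift of $E'$ that starts at $\widetilde V$, and $\theta_{E'}\in\pi$ is the element for which $\widetilde E'$ ends at $\theta_{E'}\widetilde V'$. The elements $\theta_{E'}$, $E'\notin\mathcal T$, freely generate $\pi$, and an initial subword of $w\in\pi$ is an element represented by an initial segment (possibly empty or everything) of the reduced word of $w$ in these generators. The chosen lift $\widetilde x$ of a point $x$ in the interior of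 an edge $E'$ is the point of $\widetilde E'$ over $x$. For a point $x$ of $G$, an integer $n\ge 1$ with $f^n(x)=x$, and $w\in\pi$ with $\widetilde f^n(\widetilde x)=w\widetilde x$, we say that $x$ is a periodic point with rotation element $w^{1/n}$. An edge belongs to $\alpha\in\pi$ if every cyclically reduced edge loop in the free homotopy class of $\alpha$ traverses that edge, in one direction or the other. Suppose that $V_1$ has period $m$ and rotation element $w_1^{1/m}$, and that $V_2$ has period $n$ and rotation element $w_2^{1/n}$ (the periods need not be minimal). 1. If $E$ belongs to $w_1$ but not to $w_2$, then there is an initial subword $\gamma_1$ of $w_1$ such that for every rational $r$ with $0<r<1/m$ there are integers $p\ge 0$, $q\ge 1$ with $r=p/q$ and a periodic point in $E$ with rotation element $(w_1^{p}\gamma_1)^{1/q}$. 2. If $E$ belongs to $w_2$ but not to $w_1$, then there is an initial subword $\gamma_2$ of $w_2$ such that for every rational $s$ with $0<s<1/n$ there are integers $p'\ge 0$, $q'\ge 1$ with $s=p'/q'$ and a periodic point in $E$ with rotation element $(w_2^{p'}\gamma_2)^{1/q'}$. -/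

import Mathlib

/-- A directed graph with vertex set `V` and edge set `E`.  Multiple edges are allowed,
looped edges are not. -/
structure DirGraph (V E : Type*) where
  /-- initial vertex of an edge -/
  src : E → V
  /-- terminal vertex of an edge -/
  tgt : E → V
  no_loops : ∀ e, src e ≠ tgt e

namespace DirGraph

section Combinatorics

variable {V E : Type*} (G : DirGraph V E)

/-- Initial vertex of an oriented edge: `(e, true)` is `e`, and `(e, false)` is its reverse. -/
def dartSrc (d : E × Bool) : V := if d.2 then G.src d.1 else G.tgt d.1

/-- Terminal vertex of an oriented edge. -/
def dartTgt (d : E × Bool) : V := if d.2 then G.tgt d.1 else G.src d.1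

/-- `G.IsWalk u v c`: the list `c` of oriented edges is an edge path from `u` to `v`. -/
def IsWalk : V → V → List (E × Bool) → Prop
  | u, v, [] => u = v
  | u, v, d :: c => G.dartSrc d = u ∧ IsWalk (G.dartTgt d) v c

/-- An edge path is contracted (reduced) if no edge is followed by its own reverse. -/
def Contracted (c : List (E × Bool)) : Prop :=
  c.IsChain (fun a b => b ≠ (a.1, !a.2))

/-- A contracted edge loop is cyclically reduced if moreover its first edge is not the reverse
of its last edge. -/
def CyclicallyReduced (c : List (E × Bool)) : Prop :=
  Contracted c ∧ ∀ a ∈ c.getLast?, ∀ b ∈ c.head?, b ≠ (a.1, !a.2)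

/-- A set `T` of edges is a spanning tree if any two vertices of `G` are joined by exactly one
contracted edge path with edges in `T`. -/
def IsSpanningTree (T : Set E) : Prop :=
  ∀ u v : V, ∃! c : List (E × Bool), G.IsWalk u v c ∧ Contracted c ∧ ∀ d ∈ c, d.1 ∈ T

end Combinatorics

section Realization

variable {V E : Type*} (G : DirGraph V E)

/-- The disjoint union of the discrete set of vertices and of one unit interval for each edge. -/
def Pieces (_ : DirGraph V E) : Type _ := V ⊕ (Σ _ : E, unitInterval)

instance : TopologicalSpace G.Pieces :=
  letI : TopologicalSpace V := ⊥
  inferInstanceAs (TopologicalSpace (V ⊕ (Σ _ : E, unitInterval)))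

/-- The ends of each interval are to be glued to the end vertices of the edge. -/
inductive Glue : G.Pieces → G.Pieces → Prop
  | src (e : E) : Glue (Sum.inr ⟨e, 0⟩) (Sum.inl (G.src e))
  | tgt (e : E) : Glue (Sum.inr ⟨e, 1⟩) (Sum.inl (G.tgt e))

/-- The graph as a topological space. -/
def Space : Type _ := Quot G.Glue

instance : TopologicalSpace G.Space := inferInstanceAs (TopologicalSpace (Quot G.Glue))

/-- A vertex as a point of the graph. -/
def vert (v : V) : G.Space := Quot.mk _ (Sum.inl v)

/-- The point with coordinate `t` on the (closed) edge `e`. -/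
def edge (e : E) (t : unitInterval) : G.Space := Quot.mk _ (Sum.inr ⟨e, t⟩)

/-- `f` is a vertex map: it permutes the vertices. -/
def IsVertexMap (f : C(G.Space, G.Space)) : Prop :=
  ∃ σ : Equiv.Perm V, ∀ v, f (G.vert v) = G.vert (σ v)

end Realization

section Covering

variable {V E X : Type*} {G : DirGraph V E} [TopologicalSpace X]

/-- The group of covering transformations of `p`.  The product is composition. -/
def Deck (p : C(X, G.Space)) : Subgroup (X ≃ₜ X) where
  carrier := {φ | ∀ x, p (φ x) = p x}
  mul_mem' {a b} ha hb x := (ha (b x)).trans (hb x)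
  one_mem' _ := rfl
  inv_mem' {a} ha x := by
    have h := ha (a⁻¹ x)
    rw [← h]
    exact congrArg p (a.apply_symm_apply x)

/-- `F` is obtained by lifting a homotopy from the identity to `f` to a homotopy of `X` that
starts at the identity: `F` is the end of the lifted homotopy.  (In particular `f` is homotopic
to the identity and `F` is a lift of `f`.) -/
def IsHomotopyLift (p : C(X, G.Space)) (f : C(G.Space, G.Space)) (F : C(X, X)) : Prop :=
  ∃ (H : (ContinuousMap.id G.Space).Homotopy f) (K : (ContinuousMap.id X).Homotopy F),
    ∀ t x, p (K (t, x)) = H (t, p x)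

/-- `LiftsWalk p c x y`: the edge path `c` lifts to a path in `X` from `x` to `y`. -/
def LiftsWalk (p : C(X, G.Space)) : List (E × Bool) → X → X → Prop
  | [], x, y => x = y
  | d :: c, x, y => ∃ l : C(unitInterval, X), (∀ t, p (l t) = G.edge d.1 t) ∧
      l (if d.2 then 0 else 1) = x ∧ LiftsWalk p c (l (if d.2 then 1 else 0)) y

/-- `c` is a cyclic reduction of `α`: a cyclically reduced edge loop in the free homotopy class
of `α`, that is, a loop with a lift going from some point `x` to `α x`. -/
def IsCyclicReduction (p : C(X, G.Space)) (α : Deck p) (c : List (E × Bool)) : Prop :=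
  (∃ v, G.IsWalk v v c) ∧ CyclicallyReduced c ∧ ∃ x : X, LiftsWalk p c x (α.1 x)

/-- The edge `e` belongs to `α`: every cyclic reduction of `α` uses `e` or its reverse. -/
def Belongs (p : C(X, G.Space)) (e : E) (α : Deck p) : Prop :=
  ∀ c, IsCyclicReduction p α c → ∃ d ∈ c, d.1 = e

/-- A coherent labeling of the covering space `X` with respect to the spanning tree `T`: the
chosen lifts of the vertices and of the edges in `T` form a lift of `T`, and the chosen lift of
any edge starts at the chosen lift of its initial vertex.  The covering transformation `θ e` is
the one for which the chosen lift of `e` ends at `θ e` applied to the chosen lift of the terminal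
vertex of `e`. -/
structure CoherentLabeling (p : C(X, G.Space)) (T : Set E) where
  /-- chosen lift of a vertex -/
  vLift : V → X
  /-- chosen lift of an edge -/
  eLift : E → C(unitInterval, X)
  p_vLift : ∀ v, p (vLift v) = G.vert v
  p_eLift : ∀ e t, p (eLift e t) = G.edge e t
  eLift_zero : ∀ e, eLift e 0 = vLift (G.src e)
  eLift_one_of_mem : ∀ e ∈ T, eLift e 1 = vLift (G.tgt e)
  /-- the covering transformation associated with an edge -/
  θ : E → Deck p
  eLift_one : ∀ e, eLift e 1 = (θ e).1 (vLift (G.tgt e))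

namespace CoherentLabeling

variable {p : C(X, G.Space)} {T : Set E} (L : CoherentLabeling p T)

/-- The element of the group given by a word in the generators `θ e`, for `e` not in `T`. -/
def ofWord : FreeGroup {e : E // e ∉ T} →* Deck p := FreeGroup.lift (fun e => L.θ e.1)

/-- `γ` is an initial subword of `w` (possibly empty, possibly all of `w`), where `w` is written
as a reduced word in the generators. -/
def IsInitialSubword (γ w : Deck p) : Prop :=
  ∃ l m : List ({e : E // e ∉ T} × Bool), FreeGroup.IsReduced m ∧ l <+: m ∧
    L.ofWord (FreeGroup.mk m) = w ∧ L.ofWord (FreeGroup.mk l) = γ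

/-- `y` is the chosen lift of the point `x` of the graph. -/
def IsChosenLift (x : G.Space) (y : X) : Prop :=
  (∃ v, x = G.vert v ∧ y = L.vLift v) ∨
    ∃ e t, 0 < t ∧ t < 1 ∧ x = G.edge e t ∧ y = L.eLift e t

/-- `x` is a point of `Fix (f ^ n)`, `n ≥ 1`, with rotation element `w ^ (1 / n)` with respect to
the lift `F` of `f`. -/
def HasRotationElement (f : C(G.Space, G.Space)) (F : C(X, X)) (x : G.Space) (w : Deck p)
    (n : ℕ) : Prop :=
  0 < n ∧ f^[n] x = x ∧ ∃ y, L.IsChosenLift x y ∧ F^[n] y = w.1 y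

end CoherentLabeling

end Covering

end DirGraph

/-!
The proof takes place in the universal covering `X`, which is a tree of lifts of edges. The only
geometric input is a continuous function on `X` for every lift `l` of an edge, the *height*
(`EdgeLift.height`): it equals the coordinate along `l`, and it takes only the values `0` and `1`
off the interior of `l`, namely on the two sides of `l`. It is obtained by lifting to `ℝ` the map
from `X` to the circle that wraps `l` once around and is constant elsewhere; this is where simple
connectedness is used. Since `X` is connected, the sides of two different lifts are nested: one of
the four intersections is empty, because otherwise a minimum of heights would be a nonconstant
continuous function with values `0` and `1` (`EdgeLift.height_eq_zero_of_height_eq_one`). Applied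
to successive edges, this shows that a contracted path goes from one side to the other of every edge
on it (`height_of_contracted`).

Let `x₁`, `x₂` be the chosen lifts of the two ends of `e`, so that `F ^ m` and `F ^ n` act on them
as `w₁` and `w₂`. The contracted path from `x₁` to `w₁ x₁` is a conjugate of a cyclic reduction of
`w₁`, so if `e` belongs to `w₁`, then it crosses a lift `l` of `e` on the axis of `w₁`. This lift
is `γ` applied to the chosen lift of `e` for an initial subword `γ` of `w₁`, and it separates
`w₁ ^ k x₁`, `k > 0`, from `w₁ ^ k x₁`, `k ≤ 0` (`exists_separating_powers`). If `e` does not belong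
to `w₂`, then the paths from `x₁` to the points `w₂ ^ j x₂` cross a bounded number of lifts of `e`
(`exists_bound_of_not_belongs`). As the sides of the lifts `w₁ ^ i l` are nested, it follows that
for large `a` and `k > a` the lift `w₁ ^ a l` separates `w₁ ^ k x₁` from all the points
`w₂ ^ j x₂` (`exists_separating_translates`).

Given `r`, choose a large common multiple `b` of the periods and the denominator of `r`, and put
`a = r b`. Then `F ^ b` takes `x₁` to `w₁ ^ (b / m) x₁` and `x₂` to `w₂ ^ (b / n) x₂`, where
`a < b / m` because of `r < 1 / m`. So `(w₁ ^ a γ)⁻¹ F ^ b` moves the ends of the chosen lift of `e`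
to different sides of it. By the intermediate value theorem for the height it has a fixed point on
the closed edge (`EdgeLift.exists_fixedPoint`), which is the periodic point that is required.
-/

namespace DirGraph

/-! ### The realization of a graph -/

section Realization

variable {V E : Type*} (G : DirGraph V E)

theorem edge_zero (e : E) : G.edge e 0 = G.vert (G.src e) := Quot.sound (Glue.src e)

theorem edge_one (e : E) : G.edge e 1 = G.vert (G.tgt e) := Quot.sound (Glue.tgt e)

open Classical in
/-- The normal form of a point of the graph: a vertex, or an edge together with a coordinate
different from `0` and `1`. -/
noncomputable def normalForm : G.Space → V ⊕ (Σ _ : E, unitInterval) :=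
  Quot.lift
    (Sum.elim Sum.inl fun s =>
      if s.2 = 0 then Sum.inl (G.src s.1) else if s.2 = 1 then Sum.inl (G.tgt s.1) else Sum.inr s)
    (by rintro _ _ (e | e) <;> simp)

open Classical in
theorem normalForm_edge (e : E) (t : unitInterval) : G.normalForm (G.edge e t) =
    if t = 0 then Sum.inl (G.src e) else if t = 1 then Sum.inl (G.tgt e) else Sum.inr ⟨e, t⟩ := rfl

theorem normalForm_vert (v : V) : G.normalForm (G.vert v) = Sum.inl v := rfl

theorem vert_injective : Function.Injective G.vert := fun u v h => by
  simpa [normalForm_vert] using congrArg G.normalForm h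

theorem eq_zero_or_one_of_edge_eq_vert {e : E} {t : unitInterval} {v : V}
    (h : G.edge e t = G.vert v) : t = 0 ∨ t = 1 := by
  have h := congrArg G.normalForm h
  rw [normalForm_edge, normalForm_vert] at h
  split_ifs at h <;> simp_all

theorem edge_eq_edge {e e' : E} {t t' : unitInterval} (h : G.edge e t = G.edge e' t')
    (h0 : t ≠ 0) (h1 : t ≠ 1) : e = e' ∧ t = t' := by
  have h := congrArg G.normalForm h
  rw [normalForm_edge, normalForm_edge] at h
  split_ifs at h <;> simp_all

theorem edge_injective (e : E) : Function.Injective (G.edge e) := fun t t' h => by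
  have h := congrArg G.normalForm h
  rw [normalForm_edge, normalForm_edge] at h
  have := G.no_loops e
  have := this.symm
  split_ifs at h <;> simp_all

theorem isOpen_of_isOpen_edge_preimage {S : Set G.Space}
    (h : ∀ e, IsOpen (G.edge e ⁻¹' S)) : IsOpen S := by
  let _ : TopologicalSpace V := ⊥
  have _ : DiscreteTopology V := ⟨rfl⟩
  have key (A : Set (V ⊕ (Σ _ : E, unitInterval)))
      (hA : ∀ e, IsOpen (Sigma.mk e ⁻¹' (Sum.inr ⁻¹' A))) : IsOpen A :=
    isOpen_sum_iff.2 ⟨isOpen_discrete _, isOpen_sigma_iff.2 hA⟩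
  exact key (Quot.mk G.Glue ⁻¹' S) h

theorem continuous_edge (e : E) : Continuous (G.edge e) := by
  let _ : TopologicalSpace V := ⊥
  have h : Continuous (fun t : unitInterval =>
    (Sum.inr ⟨e, t⟩ : V ⊕ (Σ _ : E, unitInterval))) := continuous_inr.comp continuous_sigmaMk
  have hq : Continuous (Quot.mk G.Glue : G.Pieces → G.Space) := continuous_coinduced_rng
  exact hq.comp h

end Realization

/-! ### Lifts of edges to a covering space -/

/-- A lift of an edge of the graph to the covering space. -/
structure EdgeLift {V E X : Type*} {G : DirGraph V E} [TopologicalSpace X]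
    (p : C(X, G.Space)) where
  /-- the edge that is lifted -/
  base : E
  /-- the lift, as a path -/
  path : C(unitInterval, X)
  proj : ∀ t, p (path t) = G.edge base t

namespace EdgeLift

variable {V E X : Type*} {G : DirGraph V E} [TopologicalSpace X] {p : C(X, G.Space)}

theorem path_injective (l : EdgeLift p) : Function.Injective l.path := fun t t' h =>
  G.edge_injective l.base (by rw [← l.proj, ← l.proj, h])

theorem exists_of_proj_eq (hp : IsCoveringMap p) {e : E} {t : unitInterval} {y : X}
    (h : p y = G.edge e t) : ∃ l : EdgeLift p, l.base = e ∧ l.path t = y := by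
  have _ : ContractibleSpace unitInterval :=
    (convex_Icc (0 : ℝ) 1).contractibleSpace ⟨0, by simp⟩
  have _ : LocallyPathConnectedSpace unitInterval :=
    (convex_Icc (0 : ℝ) 1).locallyPathConnectedSpace
  obtain ⟨l, ⟨h1, h2⟩, -⟩ :=
    hp.existsUnique_continuousMap_lifts ⟨G.edge e, G.continuous_edge e⟩ t y h
  exact ⟨⟨e, l, fun s => congrFun h2 s⟩, rfl, h1⟩

theorem eq_of_path_eq (hp : IsCoveringMap p) {l l' : EdgeLift p} (hb : l.base = l'.base)
    {t : unitInterval} (h : l.path t = l'.path t) : l = l' := by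
  have : (l.path : unitInterval → X) = l'.path :=
    hp.eq_of_comp_eq l.path.continuous l'.path.continuous
      (funext fun s => by simp [l.proj, l'.proj, hb]) t h
  cases l; cases l'
  simp only [DFunLike.coe_fn_eq] at this hb
  subst this hb
  rfl

/-- Two lifts of edges can only meet in their ends. -/
theorem eq_of_meet (hp : IsCoveringMap p) {l l' : EdgeLift p} {t t' : unitInterval}
    (h : l.path t = l'.path t') (h0 : t ≠ 0) (h1 : t ≠ 1) : l = l' := by
  obtain ⟨hb, rfl⟩ := G.edge_eq_edge ((l.proj t).symm.trans ((congrArg p h).trans (l'.proj t')))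
    h0 h1
  exact eq_of_path_eq hp hb h

/-- The translate of a lift by a covering transformation. -/
def translate (g : Deck p) (l : EdgeLift p) : EdgeLift p where
  base := l.base
  path := ⟨fun t => g.1 (l.path t), g.1.continuous.comp l.path.continuous⟩
  proj t := (g.2 _).trans (l.proj t)

@[simp] theorem translate_path (g : Deck p) (l : EdgeLift p) (t : unitInterval) :
    (l.translate g).path t = g.1 (l.path t) := rfl

end EdgeLift

section Weak

variable {V E X : Type*} {G : DirGraph V E} [TopologicalSpace X] {p : C(X, G.Space)}

/-- The covering space carries the weak topology determined by the lifts of the edges. -/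
theorem isOpen_of_isOpen_path_preimage (hp : IsCoveringMap p) {S : Set X}
    (h : ∀ l : EdgeLift p, IsOpen (l.path ⁻¹' S)) : IsOpen S := by
  rw [isOpen_iff_mem_nhds]
  intro y hy
  obtain ⟨φ, hyφ, hφ⟩ := hp.isLocalHomeomorph y
  have hU : IsOpen {x : G.Space | x ∈ φ.target ∧ φ.symm x ∈ S} := by
    refine G.isOpen_of_isOpen_edge_preimage fun e => isOpen_iff_mem_nhds.2 ?_
    rintro t ⟨ht, htS⟩
    obtain ⟨l, rfl, hl⟩ := EdgeLift.exists_of_proj_eq hp (y := φ.symm (G.edge e t)) (t := t)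
      (e := e) (by rw [hφ]; exact φ.right_inv ht)
    have hn : l.path ⁻¹' S ∩ l.path ⁻¹' φ.source ∈ nhds t := by
      refine ((h l).inter (φ.open_source.preimage l.path.continuous)).mem_nhds ⟨?_, ?_⟩
      · simpa [hl] using htS
      · simpa [hl] using φ.map_target ht
    refine Filter.mem_of_superset hn ?_
    rintro s ⟨hs, hs'⟩
    have he : φ (l.path s) = G.edge l.base s := by rw [← hφ]; exact l.proj s
    refine ⟨?_, ?_⟩
    · rw [← he]; exact φ.map_source hs'
    · rw [← he, φ.left_inv hs']; exact hs
  refine Filter.mem_of_superset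
    ((φ.open_source.inter (hU.preimage p.continuous)).mem_nhds ⟨hyφ, ?_⟩) ?_
  · rw [hφ]
    refine ⟨φ.map_source hyφ, ?_⟩
    rw [φ.left_inv hyφ]; exact hy
  · rintro z ⟨hz, hz'⟩
    rw [hφ] at hz'
    have := hz'.2
    rwa [φ.left_inv hz] at this

theorem EdgeLift.isClosed_range (hp : IsCoveringMap p) (l : EdgeLift p) :
    IsClosed (Set.range l.path) := by
  refine ⟨isOpen_of_isOpen_path_preimage hp fun l' => ?_⟩
  by_cases hl : l' = l
  · subst hl
    convert isOpen_empty
    exact Set.eq_empty_of_forall_notMem fun t ht => ht ⟨t, rfl⟩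
  · have : (l'.path ⁻¹' Set.range l.path).Finite :=
      (Set.toFinite {0, 1}).subset fun t ⟨s, hs⟩ => by
        by_contra! h
        simp only [Set.mem_insert_iff, Set.mem_singleton_iff, not_or] at h
        exact hl (eq_of_meet hp hs.symm h.1 h.2)
    exact this.isClosed.isOpen_compl

theorem continuous_of_continuous_path {Y : Type*} [TopologicalSpace Y] (hp : IsCoveringMap p)
    {g : X → Y} (h : ∀ l : EdgeLift p, Continuous (g ∘ l.path)) : Continuous g :=
  continuous_def.2 fun _ hs => isOpen_of_isOpen_path_preimage hp fun l => (h l).isOpen_preimage _ hs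

theorem locallyPathConnectedSpace_of_isCoveringMap (hp : IsCoveringMap p) :
    LocallyPathConnectedSpace X := by
  have _ : LocallyPathConnectedSpace unitInterval :=
    (convex_Icc (0 : ℝ) 1).locallyPathConnectedSpace
  refine locallyPathConnectedSpace_iff_isOpen_pathComponentIn.2 fun x u hu =>
    isOpen_of_isOpen_path_preimage hp fun l => isOpen_iff_mem_nhds.2 fun t ht => ?_
  have hx : l.path t ∈ pathComponentIn u x := ht
  have hxu : l.path t ∈ u := pathComponentIn_subset hx
  have htu : t ∈ l.path ⁻¹' u := hxu
  refine Filter.mem_of_superset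
    (((hu.preimage l.path.continuous).pathComponentIn t).mem_nhds (mem_pathComponentIn_self htu))
    fun s hs => ?_
  exact hx.trans ((JoinedIn.map hs l.path.continuous).mono (Set.image_preimage_subset _ _))

/-- In a connected covering space a nonempty set that contains every lift of an edge which it
meets is everything. -/
theorem eq_univ_of_saturated [PreconnectedSpace X] (hp : IsCoveringMap p) {S : Set X}
    (hne : S.Nonempty) (h : ∀ (l : EdgeLift p) t t', l.path t ∈ S → l.path t' ∈ S) :
    S = Set.univ := by
  refine IsClopen.eq_univ ⟨⟨?_⟩, ?_⟩ hne
  all_goals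
    refine isOpen_of_isOpen_path_preimage hp fun l => ?_
    by_cases h0 : l.path 0 ∈ S
  · convert isOpen_empty
    exact Set.eq_empty_of_forall_notMem fun t ht => ht (h l _ _ h0)
  · convert isOpen_univ
    exact Set.eq_univ_of_forall fun t ht => h0 (h l _ _ ht)
  · convert isOpen_univ
    exact Set.eq_univ_of_forall fun t => h l _ _ h0
  · convert isOpen_empty
    exact Set.eq_empty_of_forall_notMem fun t ht => h0 (h l _ _ ht)

end Weak

/-! ### Heights: every lift of an edge separates the universal covering -/

theorem eq_of_forall_eq_zero_or_one {A : Type*} [TopologicalSpace A] [PreconnectedSpace A]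
    {g : A → ℝ} (hg : Continuous g) (h : ∀ a, g a = 0 ∨ g a = 1) (a b : A) : g a = g b := by
  have aux : ∀ a b, g a = 0 → g b = 1 → False := fun a b ha hb => by
    obtain ⟨c, hc⟩ := intermediate_value_univ a b hg
      (show (1 / 2 : ℝ) ∈ Set.Icc (g a) (g b) by rw [ha, hb]; norm_num)
    rcases h c with h | h <;> rw [h] at hc <;> norm_num at hc
  rcases h a with ha | ha <;> rcases h b with hb | hb
  · rw [ha, hb]
  · exact (aux a b ha hb).elim
  · exact (aux b a hb ha).elim
  · rw [ha, hb]

namespace EdgeLift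

variable {V E X : Type*} {G : DirGraph V E} [TopologicalSpace X] [SimplyConnectedSpace X]
  {p : C(X, G.Space)} (hp : IsCoveringMap p)

include hp

/-- The height is a lift to `ℝ` of the map to the circle that wraps `l` once around and sends
everything else to the base point. -/
theorem exists_height (l : EdgeLift p) : ∃ ρ : C(X, ℝ), (∀ t, ρ (l.path t) = t) ∧
    ∀ y, (∃ t, l.path t = y) ∨ ρ y = 0 ∨ ρ y = 1 := by
  classical
  have _ : LocallyPathConnectedSpace X := locallyPathConnectedSpace_of_isCoveringMap hp
  let κ : X → AddCircle (1 : ℝ) := fun y =>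
    if h : ∃ t, l.path t = y then ((h.choose : ℝ) : AddCircle (1 : ℝ)) else 0
  have hκ (t : unitInterval) : κ (l.path t) = ((t : ℝ) : AddCircle (1 : ℝ)) := by
    have h : ∃ s, l.path s = l.path t := ⟨t, rfl⟩
    simp only [κ, dif_pos h]
    rw [l.path_injective h.choose_spec]
  have hκ0 (y : X) (h : ¬ ∃ t, l.path t = y) : κ y = 0 := dif_neg h
  have hκc : Continuous κ := by
    refine continuous_of_continuous_path hp fun l' => ?_
    by_cases hl : l' = l
    · subst hl
      have : κ ∘ l'.path = fun t : unitInterval => ((t : ℝ) : AddCircle (1 : ℝ)) := funext hκ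
      rw [this]
      exact (AddCircle.continuous_mk' 1).comp continuous_subtype_val
    · have : κ ∘ l'.path = fun _ => 0 := by
        funext t
        by_cases h : ∃ s, l.path s = l'.path t
        · obtain ⟨s, hs⟩ := h
          rw [Function.comp_apply, ← hs, hκ]
          by_cases h0 : s = 0
          · simp [h0]
          by_cases h1 : s = 1
          · simp [h1]
          exact absurd (eq_of_meet hp hs h0 h1).symm hl
        · exact hκ0 _ h
      rw [this]
      exact continuous_const
  have hcov := AddCircle.isCoveringMap_coe (𝕜 := ℝ) 1
  obtain ⟨ρ, ⟨h0, h1⟩, -⟩ := hcov.existsUnique_continuousMap_lifts ⟨κ, hκc⟩ (l.path 0) (0 : ℝ)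
    (by simp [hκ])
  have hρ (t : unitInterval) : ρ (l.path t) = t := by
    refine congrFun (hcov.eq_of_comp_eq (g₁ := fun t => ρ (l.path t))
      (g₂ := fun t : unitInterval => (t : ℝ)) (by fun_prop) (by fun_prop)
      (funext fun s => ?_) 0 (by simpa using h0)) t
    exact (congrFun h1 (l.path s)).trans (hκ s)
  have hint (y : X) (h : ¬ ∃ t, l.path t = y) : ∃ n : ℤ, ρ y = n := by
    have h2 : ((ρ y : ℝ) : AddCircle (1 : ℝ)) = 0 := (congrFun h1 y).trans (hκ0 y h)
    obtain ⟨n, hn⟩ := (AddCircle.coe_eq_zero_iff 1).1 h2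
    exact ⟨n, by simpa using hn.symm⟩
  refine ⟨ρ, hρ, fun y => or_iff_not_imp_left.2 fun h => ?_⟩
  obtain ⟨n, hn⟩ := hint y h
  -- a value beyond `[0, 1]` is impossible: a half-integer beyond `[0, 1]` would also be a value
  have hle : n ≤ 1 := by
    by_contra! hc
    have hc' : (2 : ℝ) ≤ n := by exact_mod_cast hc
    obtain ⟨z, hz⟩ := intermediate_value_univ (l.path 0) y ρ.continuous
      (show (3 / 2 : ℝ) ∈ Set.Icc _ _ by rw [h0, hn]; constructor <;> linarith)
    by_cases hzl : ∃ t, l.path t = z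
    · obtain ⟨t, rfl⟩ := hzl
      rw [hρ] at hz
      linarith [t.2.2]
    · obtain ⟨k, hk⟩ := hint z hzl
      rw [hk] at hz
      have h2 : (2 * k : ℝ) = 3 := by linarith
      have h3 : 2 * k = 3 := by exact_mod_cast h2
      omega
  have hge : 0 ≤ n := by
    by_contra! hc
    have hc' : (n : ℝ) ≤ -1 := by exact_mod_cast (by omega : n ≤ -1)
    obtain ⟨z, hz⟩ := intermediate_value_univ y (l.path 0) ρ.continuous
      (show (-1 / 2 : ℝ) ∈ Set.Icc _ _ by rw [h0, hn]; constructor <;> linarith)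
    by_cases hzl : ∃ t, l.path t = z
    · obtain ⟨t, rfl⟩ := hzl
      rw [hρ] at hz
      linarith [t.2.1]
    · obtain ⟨k, hk⟩ := hint z hzl
      rw [hk] at hz
      have h2 : (2 * k : ℝ) = -1 := by linarith
      have h3 : 2 * k = -1 := by exact_mod_cast h2
      omega
  have : n = 0 ∨ n = 1 := by omega
  rcases this with rfl | rfl <;> simp [hn]

omit hp in
/-- The height with respect to a lift `l` of an edge, oriented by `b`: the continuous function on
the universal covering that grows from `0` to `1` along `l` if `b` is true, and from `0` to `1`
along the reverse of `l` if `b` is false, and that takes the values `0` and `1` only on the two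
sides of `l`. -/
noncomputable def height (hp : IsCoveringMap p) (l : EdgeLift p) (b : Bool) : C(X, ℝ) :=
  if b then (exists_height hp l).choose else 1 - (exists_height hp l).choose

theorem height_path (l : EdgeLift p) (b : Bool) (t : unitInterval) :
    l.height hp b (l.path t) = if b then (t : ℝ) else 1 - t := by
  have h := (exists_height hp l).choose_spec.1 t
  cases b
  · exact congrArg (1 - ·) h
  · exact h

theorem height_start (l : EdgeLift p) (b : Bool) :
    l.height hp b (l.path (if b then 0 else 1)) = 0 := by
  cases b <;> simp [height_path]

theorem height_end (l : EdgeLift p) (b : Bool) :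
    l.height hp b (l.path (if b then 1 else 0)) = 1 := by
  cases b <;> simp [height_path]

theorem height_eq_zero_or_one (l : EdgeLift p) (b : Bool) {y : X}
    (hy : ∀ t, l.path t = y → t = 0 ∨ t = 1) : l.height hp b y = 0 ∨ l.height hp b y = 1 := by
  rcases (exists_height hp l).choose_spec.2 y with ⟨t, rfl⟩ | h
  · rw [height_path]
    rcases hy t rfl with rfl | rfl <;> cases b <;> simp
  · cases b
    · rcases h with h | h
      · exact Or.inr ((congrArg (1 - ·) h).trans (sub_zero 1))
      · exact Or.inl ((congrArg (1 - ·) h).trans (sub_self 1))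
    · exact h

theorem height_not (l : EdgeLift p) (b : Bool) (y : X) :
    l.height hp (!b) y = 1 - l.height hp b y := by
  cases b <;> simp [height]

theorem height_path_eq_zero_or_one {l l' : EdgeLift p} (hl : l ≠ l') (b : Bool)
    (t : unitInterval) : l.height hp b (l'.path t) = 0 ∨ l.height hp b (l'.path t) = 1 := by
  refine height_eq_zero_or_one hp l b fun s hs => ?_
  by_contra! h
  exact hl (eq_of_meet hp hs h.1 h.2)

theorem height_path_eq_of_ne {l l' : EdgeLift p} (hl : l ≠ l') (b : Bool) (t t' : unitInterval) :
    l.height hp b (l'.path t) = l.height hp b (l'.path t') :=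
  eq_of_forall_eq_zero_or_one (g := fun t => l.height hp b (l'.path t)) (by fun_prop)
    (height_path_eq_zero_or_one hp hl b) t t'

theorem height_translate (g : Deck p) (l : EdgeLift p) (b : Bool) (y : X) :
    (l.translate g).height hp b (g.1 y) = l.height hp b y := by
  have hg : Continuous fun y => g.1 y := g.1.continuous
  have key := eq_of_forall_eq_zero_or_one
    (g := fun y => ((l.translate g).height hp b (g.1 y) - l.height hp b y) ^ 2) (by fun_prop) ?_ y
    (l.path 0)
  · have h1 := height_path hp (l.translate g) b 0
    rw [translate_path] at h1
    rw [h1, height_path hp, sub_self] at key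
    exact sub_eq_zero.1 (by simpa using key)
  · intro y
    by_cases hy : ∃ t, l.path t = y
    · obtain ⟨t, rfl⟩ := hy
      have h1 := height_path hp (l.translate g) b t
      rw [translate_path] at h1
      rw [h1, height_path hp]
      simp
    · have h1 := height_eq_zero_or_one hp l b (y := y) fun t ht => (hy ⟨t, ht⟩).elim
      have h2 := height_eq_zero_or_one hp (l.translate g) b (y := g.1 y) fun t ht =>
        (hy ⟨t, g.1.injective ht⟩).elim
      rcases h1 with h1 | h1 <;> rcases h2 with h2 | h2 <;> simp [h1, h2]

theorem height_translate' (g : Deck p) (l : EdgeLift p) (b : Bool) (y : X) :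
    (l.translate g).height hp b y = l.height hp b ((g⁻¹).1 y) := by
  rw [← height_translate hp g l b]
  exact congrArg _ (g.1.apply_symm_apply y).symm

/-- If each of two lifts lies on the side of height `0` of the other one, then the sides of
height `1` are disjoint. -/
theorem height_eq_zero_of_height_eq_one {l l' : EdgeLift p} (hl : l ≠ l') {b b' : Bool}
    {t t' : unitInterval} (h : l.height hp b (l'.path t) = 0) (h' : l'.height hp b' (l.path t') = 0)
    {y : X} (hy : l.height hp b y = 1) (hy' : l'.height hp b' y = 1) : False := by
  have hz (s) : l.height hp b (l'.path s) = 0 := (height_path_eq_of_ne hp hl b s t).trans h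
  have hz' (s) : l'.height hp b' (l.path s) = 0 :=
    (height_path_eq_of_ne hp hl.symm b' s t').trans h'
  have hnn (l : EdgeLift p) (b : Bool) (y : X) : 0 ≤ l.height hp b y := by
    by_cases hy : ∃ t, l.path t = y
    · obtain ⟨t, rfl⟩ := hy
      rw [height_path]
      split_ifs
      · exact t.2.1
      · linarith [t.2.2]
    · rcases height_eq_zero_or_one hp l b (y := y) fun t ht => (hy ⟨t, ht⟩).elim with h | h <;>
        simp [h]
  -- the minimum of the two heights takes the values `0` and `1` only
  have key := eq_of_forall_eq_zero_or_one
    (g := fun y => min (l.height hp b y) (l'.height hp b' y)) (by fun_prop) ?_ y (l.path 0)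
  · simp [hy, hy', hz', hnn] at key
  · intro z
    by_cases h1 : ∃ t, l.path t = z
    · obtain ⟨s, rfl⟩ := h1
      simp [hz', hnn]
    by_cases h2 : ∃ t, l'.path t = z
    · obtain ⟨s, rfl⟩ := h2
      simp [hz, hnn]
    have h1 := height_eq_zero_or_one hp l b (y := z) fun t ht => (h1 ⟨t, ht⟩).elim
    have h2 := height_eq_zero_or_one hp l' b' (y := z) fun t ht => (h2 ⟨t, ht⟩).elim
    rcases h1 with h1 | h1 <;> rcases h2 with h2 | h2 <;> simp [h1, h2]

/-- One of the four intersections of a side of `l` with a side of another lift `l'` is empty. -/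
theorem exists_quadrant_eq_empty {l l' : EdgeLift p} (hl : l ≠ l') (b b' : Bool)
    {y₀₀ y₀₁ y₁₀ y₁₁ : X} (h₀₀ : l.height hp b y₀₀ = 0) (h₀₀' : l'.height hp b' y₀₀ = 0)
    (h₀₁ : l.height hp b y₀₁ = 0) (h₀₁' : l'.height hp b' y₀₁ = 1)
    (h₁₀ : l.height hp b y₁₀ = 1) (h₁₀' : l'.height hp b' y₁₀ = 0)
    (h₁₁ : l.height hp b y₁₁ = 1) (h₁₁' : l'.height hp b' y₁₁ = 1) : False := by
  rcases height_path_eq_zero_or_one hp hl b 0 with h | h <;>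
    rcases height_path_eq_zero_or_one hp hl.symm b' 0 with h' | h'
  · exact height_eq_zero_of_height_eq_one hp hl h h' h₁₁ h₁₁'
  · exact height_eq_zero_of_height_eq_one hp hl h (b' := !b') (t' := 0) (y := y₁₀)
      (by rw [height_not, h', sub_self]) h₁₀ (by rw [height_not, h₁₀', sub_zero])
  · exact height_eq_zero_of_height_eq_one hp hl (b := !b) (t := 0) (y := y₀₁)
      (by rw [height_not, h, sub_self]) h' (by rw [height_not, h₀₁, sub_zero]) h₀₁'
  · exact height_eq_zero_of_height_eq_one hp hl (b := !b) (t := 0) (b' := !b') (t' := 0) (y := y₀₀)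
      (by rw [height_not, h, sub_self]) (by rw [height_not, h', sub_self])
      (by rw [height_not, h₀₀, sub_zero]) (by rw [height_not, h₀₀', sub_zero])

/-- A map under which the ends of a lift of an edge come to lie on different sides of it (or stay
in place) has a fixed point on this lift. -/
theorem exists_fixedPoint (l : EdgeLift p) (h : C(X, X)) {b : Bool}
    (h0 : l.height hp b (h (l.path 0)) = 0) (h1 : l.height hp b (h (l.path 1)) = 1) :
    ∃ t, h (l.path t) = l.path t := by
  -- a coincidence of heights is a fixed point if the height is neither `0` nor `1`
  have hfix (t : unitInterval) (ht0 : t ≠ 0) (ht1 : t ≠ 1)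
      (ht : l.height hp true (h (l.path t)) = t) : h (l.path t) = l.path t := by
    by_cases hx : ∃ s, l.path s = h (l.path t)
    · obtain ⟨s, hs⟩ := hx
      rw [← hs, height_path] at ht
      have : s = t := Subtype.ext (by simpa using ht)
      rw [← hs, this]
    · rcases height_eq_zero_or_one hp l true (y := h (l.path t)) fun s hs => (hx ⟨s, hs⟩).elim
        with hh | hh <;> rw [hh] at ht
      · exact (ht0 (Subtype.ext ht.symm)).elim
      · exact (ht1 (Subtype.ext ht.symm)).elim
  by_contra! hne
  have hcont : Continuous fun t : unitInterval => l.height hp true (h (l.path t)) - t := by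
    fun_prop
  have h0' := h0
  have h1' := h1
  rcases b with _ | _
  · rw [← Bool.not_true, height_not] at h0' h1'
    obtain ⟨r, hr⟩ := intermediate_value_univ 1 0 hcont
      (show (0 : ℝ) ∈ Set.Icc _ _ by
        constructor <;> simp only [Set.Icc.coe_zero, Set.Icc.coe_one] <;> linarith)
    have hr : l.height hp true (h (l.path r)) - r = 0 := hr
    refine hne r (hfix r ?_ ?_ (by linarith))
    · rintro rfl
      simp only [Set.Icc.coe_zero] at hr
      linarith
    · rintro rfl
      simp only [Set.Icc.coe_one] at hr
      linarith
  · -- near an end of the lift, the image stays off the lift, so that its height is constant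
    have hnear (x : unitInterval) (hx : l.path x ≠ h (l.path x)) (hx' : x = 0 ∨ x = 1)
        (hhx : l.height hp true (h (l.path x)) = x) :
        ∀ᶠ s in nhds x, l.height hp true (h (l.path s)) = x := by
      have hmem : h (l.path x) ∉ Set.range l.path := by
        rintro ⟨s, hs⟩
        rw [← hs, height_path] at hhx
        have : s = x := Subtype.ext (by simpa using hhx)
        exact hx (by rw [← hs, this])
      have hc : Continuous fun s => h (l.path s) := by fun_prop
      have e1 := hc.continuousAt.eventually_mem ((isClosed_range hp l).isOpen_compl.mem_nhds hmem)
      have hc2 : Continuous fun s => l.height hp true (h (l.path s)) := by fun_prop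
      have e2 := hc2.continuousAt.eventually_mem (Metric.ball_mem_nhds _ one_pos) (x := x)
      filter_upwards [e1, e2] with s hs1 hs2
      rw [Metric.mem_ball, hhx, Real.dist_eq] at hs2
      rcases hx' with rfl | rfl <;>
        rcases height_eq_zero_or_one hp l true (y := h (l.path s)) fun t ht => (hs1 ⟨t, ht⟩).elim
          with hh | hh <;> first | simpa using hh | norm_num [hh] at hs2
    have n0 := hnear 0 (hne 0).symm (Or.inl rfl) (by simpa using h0)
    have n1 := hnear 1 (hne 1).symm (Or.inr rfl) (by simpa using h1)
    have hev0 : ∃ s : unitInterval, s ≠ 0 ∧ s ≠ 1 ∧ l.height hp true (h (l.path s)) ≤ s := by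
      have := nhdsGT_neBot_of_exists_gt ⟨1, zero_lt_one (α := unitInterval)⟩
      obtain ⟨s, hs, hs'⟩ := ((n0.filter_mono nhdsWithin_le_nhds).and
        (Ioo_mem_nhdsGT (zero_lt_one (α := unitInterval)))).exists
      exact ⟨s, hs'.1.ne', hs'.2.ne, hs.le.trans s.2.1⟩
    have hev1 : ∃ s : unitInterval, s ≠ 0 ∧ s ≠ 1 ∧ s ≤ l.height hp true (h (l.path s)) := by
      have := nhdsLT_neBot_of_exists_lt ⟨0, zero_lt_one (α := unitInterval)⟩
      obtain ⟨s, hs, hs'⟩ := ((n1.filter_mono nhdsWithin_le_nhds).and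
        (Ioo_mem_nhdsLT (zero_lt_one (α := unitInterval)))).exists
      exact ⟨s, hs'.1.ne', hs'.2.ne, s.2.2.trans hs.ge⟩
    obtain ⟨s, hs0, hs1, hs⟩ := hev0
    obtain ⟨t, ht0, ht1, ht⟩ := hev1
    obtain ⟨r, hr, hr0⟩ := (isPreconnected_uIcc (a := s) (b := t)).intermediate_value
      Set.left_mem_uIcc Set.right_mem_uIcc hcont.continuousOn
      (show (0 : ℝ) ∈ Set.Icc _ _ from ⟨by simpa using hs, by simpa using ht⟩)
    refine hne r (hfix r ?_ ?_ (sub_eq_zero.1 hr0))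
    · rintro rfl
      rcases Set.mem_uIcc.1 hr with hr | hr
      · exact hs0 (le_antisymm hr.1 s.2.1)
      · exact ht0 (le_antisymm hr.1 t.2.1)
    · rintro rfl
      rcases Set.mem_uIcc.1 hr with hr | hr
      · exact ht1 (le_antisymm t.2.2 hr.2)
      · exact hs1 (le_antisymm s.2.2 hr.2)

end EdgeLift

/-! ### Contracted edge paths as reduced words -/

section Words

variable {E : Type*} {c c₁ c₂ : List (E × Bool)}

theorem contracted_iff_isReduced : Contracted c ↔ FreeGroup.IsReduced c := by
  have : (fun a b : E × Bool => b ≠ (a.1, !a.2)) = fun a b => a.1 = b.1 → a.2 = b.2 := by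
    funext ⟨e, s⟩ ⟨e', s'⟩
    refine propext ?_
    rw [ne_eq, Prod.mk.injEq, not_and, eq_comm (a := e')]
    cases s <;> cases s' <;> simp
  rw [Contracted, FreeGroup.IsReduced, this]

theorem cyclicallyReduced_iff_isCyclicallyReduced :
    CyclicallyReduced c ↔ FreeGroup.IsCyclicallyReduced c := by
  rw [CyclicallyReduced, FreeGroup.IsCyclicallyReduced, contracted_iff_isReduced]
  refine and_congr_right fun _ => forall₄_congr fun a _ b _ => ?_
  obtain ⟨e, s⟩ := a
  obtain ⟨e', s'⟩ := b
  rw [ne_eq, Prod.mk.injEq, not_and, eq_comm (a := e')]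
  cases s <;> cases s' <;> simp

theorem isReduced_invRev (h : FreeGroup.IsReduced c) : FreeGroup.IsReduced (FreeGroup.invRev c) :=
  FreeGroup.isReduced_iff_not_step.2 fun L hL =>
    h.not_step (L₂ := FreeGroup.invRev L) (FreeGroup.Red.step_invRev_iff.1
      (by rwa [FreeGroup.invRev_invRev]))

end Words

/-! ### Lifts of edge paths -/

section Walks

variable {V E X : Type*} {G : DirGraph V E} [TopologicalSpace X] {p : C(X, G.Space)}
  {c c' : List (E × Bool)} {d : E × Bool} {x y z : X}

theorem EdgeLift.proj_start (l : EdgeLift p) (b : Bool) :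
    p (l.path (if b then 0 else 1)) = G.vert (G.dartSrc (l.base, b)) := by
  cases b <;> simp [l.proj, dartSrc, edge_zero, edge_one]

theorem EdgeLift.proj_end (l : EdgeLift p) (b : Bool) :
    p (l.path (if b then 1 else 0)) = G.vert (G.dartTgt (l.base, b)) := by
  cases b <;> simp [l.proj, dartTgt, edge_zero, edge_one]

theorem liftsWalk_cons : LiftsWalk p (d :: c) x y ↔ ∃ l : EdgeLift p, l.base = d.1 ∧
    l.path (if d.2 then 0 else 1) = x ∧ LiftsWalk p c (l.path (if d.2 then 1 else 0)) y :=
  ⟨fun ⟨l, h1, h2, h3⟩ => ⟨⟨d.1, l, h1⟩, rfl, h2, h3⟩,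
    fun ⟨l, h1, h2, h3⟩ => ⟨l.path, fun t => h1 ▸ l.proj t, h2, h3⟩⟩

theorem liftsWalk_append :
    LiftsWalk p (c ++ c') x z ↔ ∃ y, LiftsWalk p c x y ∧ LiftsWalk p c' y z := by
  induction c generalizing x with
  | nil => exact ⟨fun h => ⟨x, rfl, h⟩, fun ⟨y, h, h'⟩ => by obtain rfl : x = y := h; exact h'⟩
  | cons d c ih =>
    simp only [List.cons_append, liftsWalk_cons, ih]
    exact ⟨fun ⟨l, h1, h2, y, h3, h4⟩ => ⟨y, ⟨l, h1, h2, h3⟩, h4⟩,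
      fun ⟨y, ⟨l, h1, h2, h3⟩, h4⟩ => ⟨l, h1, h2, y, h3, h4⟩⟩

theorem LiftsWalk.translate (g : Deck p) (h : LiftsWalk p c x y) :
    LiftsWalk p c (g.1 x) (g.1 y) := by
  induction c generalizing x with
  | nil => exact congrArg g.1 h
  | cons d c ih =>
    obtain ⟨l, h1, rfl, h3⟩ := liftsWalk_cons.1 h
    exact liftsWalk_cons.2 ⟨l.translate g, h1, rfl, ih h3⟩

theorem LiftsWalk.right_unique (hp : IsCoveringMap p) (h : LiftsWalk p c x y)
    (h' : LiftsWalk p c x z) : y = z := by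
  induction c generalizing x with
  | nil => exact (Eq.symm h).trans h'
  | cons d c ih =>
    obtain ⟨l, h1, rfl, h3⟩ := liftsWalk_cons.1 h
    obtain ⟨l', h1', h2', h3'⟩ := liftsWalk_cons.1 h'
    obtain rfl := EdgeLift.eq_of_path_eq hp (h1'.trans h1.symm) h2'
    exact ih h3 h3'

theorem liftsWalk_singleton (l : EdgeLift p) (b : Bool) : LiftsWalk p [(l.base, b)]
    (l.path (if b then 0 else 1)) (l.path (if b then 1 else 0)) :=
  liftsWalk_cons.2 ⟨l, rfl, rfl, rfl⟩

theorem LiftsWalk.invRev (h : LiftsWalk p c x y) : LiftsWalk p (FreeGroup.invRev c) y x := by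
  induction c generalizing x with
  | nil => exact Eq.symm h
  | cons d c ih =>
    obtain ⟨l, h1, rfl, h3⟩ := liftsWalk_cons.1 h
    rw [FreeGroup.invRev_cons]
    refine liftsWalk_append.2 ⟨_, ih h3, ?_⟩
    obtain ⟨e, b⟩ := d
    subst h1
    have := liftsWalk_singleton l (!b)
    cases b <;> exact this

theorem LiftsWalk.exists_eq_vert (h : LiftsWalk p c x y) {u : V} (hx : p x = G.vert u) :
    ∃ v, p y = G.vert v := by
  induction c generalizing x u with
  | nil => obtain rfl : x = y := h; exact ⟨u, hx⟩
  | cons d c ih =>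
    obtain ⟨l, h1, rfl, h3⟩ := liftsWalk_cons.1 h
    exact ih h3 (l.proj_end d.2)

theorem LiftsWalk.isWalk (h : LiftsWalk p c x y) {u v : V} (hx : p x = G.vert u)
    (hy : p y = G.vert v) : G.IsWalk u v c := by
  induction c generalizing x u with
  | nil => obtain rfl : x = y := h; exact G.vert_injective (hx.symm.trans hy)
  | cons d c ih =>
    obtain ⟨l, h1, rfl, h3⟩ := liftsWalk_cons.1 h
    obtain ⟨e, b⟩ := d
    subst h1
    exact ⟨G.vert_injective ((l.proj_start b).symm.trans hx), ih h3 (l.proj_end b)⟩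

theorem LiftsWalk.pow {g : Deck p} (h : LiftsWalk p c x (g.1 x)) (n : ℕ) :
    LiftsWalk p (List.replicate n c).flatten x ((g ^ n).1 x) := by
  induction n with
  | zero => exact rfl
  | succ n ih =>
    rw [List.replicate_succ, List.flatten_cons]
    refine liftsWalk_append.2 ⟨_, h, ?_⟩
    rw [pow_succ']
    exact ih.translate g

/-- Cancelling an edge that is followed by its reverse, one sees that two points which are joined
by an edge path are joined by a contracted one. -/
theorem LiftsWalk.exists_contracted (hp : IsCoveringMap p) (h : LiftsWalk p c x y) :
    ∃ c, Contracted c ∧ LiftsWalk p c x y := by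
  simp only [contracted_iff_isReduced]
  induction c generalizing x with
  | nil => exact ⟨[], by simp, h⟩
  | cons d c ih =>
    obtain ⟨l, h1, rfl, h3⟩ := liftsWalk_cons.1 h
    obtain ⟨e, b⟩ := d
    subst h1
    obtain ⟨c', hc', h4⟩ := ih h3
    match c', hc', h4 with
    | [], _, h4 => exact ⟨[(l.base, b)], by simp, liftsWalk_cons.2 ⟨l, rfl, rfl, h4⟩⟩
    | (e', b') :: c', hc', h4 =>
      by_cases hd : l.base = e' → b = b'
      · exact ⟨(l.base, b) :: (e', b') :: c', FreeGroup.isReduced_cons_cons.2 ⟨hd, hc'⟩,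
          liftsWalk_cons.2 ⟨l, rfl, rfl, h4⟩⟩
      · push Not at hd
        obtain ⟨rfl, hb⟩ := hd
        obtain rfl : b' = !b := by cases b <;> cases b' <;> simp_all
        obtain ⟨l', h5, h6, h7⟩ := liftsWalk_cons.1 h4
        have hl : l' = l := by
          refine EdgeLift.eq_of_path_eq hp h5 (t := if !b then 0 else 1) ?_
          rw [h6]
          cases b <;> rfl
        subst hl
        refine ⟨c', hc'.infix ⟨[(l'.base, !b)], [], by simp⟩, ?_⟩
        cases b <;> exact h7

/-- Any two points over vertices are joined by the lift of an edge path. -/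
theorem exists_liftsWalk [PreconnectedSpace X] (hp : IsCoveringMap p) {u v : V}
    (hx : p x = G.vert u) (hy : p y = G.vert v) : ∃ c, LiftsWalk p c x y := by
  -- edges whose initial point can be reached from `x`, together with `x` itself
  let S : Set X := {z | z = x ∨ ∃ (l : EdgeLift p) (t : unitInterval),
    l.path t = z ∧ ∃ c, LiftsWalk p c x (l.path 0)}
  have hone (l : EdgeLift p) : (∃ c, LiftsWalk p c x (l.path 0)) ↔
      ∃ c, LiftsWalk p c x (l.path 1) :=
    ⟨fun ⟨c, hc⟩ => ⟨c ++ [(l.base, true)], liftsWalk_append.2 ⟨_, hc, liftsWalk_singleton l true⟩⟩,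
      fun ⟨c, hc⟩ =>
        ⟨c ++ [(l.base, false)], liftsWalk_append.2 ⟨_, hc, liftsWalk_singleton l false⟩⟩⟩
  have hvert {z : X} {v : V} (hz : p z = G.vert v) (hS : z ∈ S) : ∃ c, LiftsWalk p c x z := by
    rcases hS with rfl | ⟨l, t, rfl, hc⟩
    · exact ⟨[], rfl⟩
    · rw [l.proj] at hz
      rcases G.eq_zero_or_one_of_edge_eq_vert hz with rfl | rfl
      · exact hc
      · exact (hone l).1 hc
  have hS : S = Set.univ := by
    refine eq_univ_of_saturated hp ⟨x, Or.inl rfl⟩ fun l t t' ht => ?_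
    refine Or.inr ⟨l, t', rfl, ?_⟩
    by_cases h0 : t = 0
    · subst h0
      exact hvert (by rw [l.proj, edge_zero]) ht
    by_cases h1 : t = 1
    · subst h1
      exact (hone l).2 (hvert (by rw [l.proj, edge_one]) ht)
    rcases ht with rfl | ⟨l', s, hs, hc⟩
    · rw [l.proj] at hx
      rcases G.eq_zero_or_one_of_edge_eq_vert hx with h | h
      exacts [(h0 h).elim, (h1 h).elim]
    · rwa [EdgeLift.eq_of_meet hp hs.symm h0 h1]
  exact hvert hy (hS ▸ Set.mem_univ y)

end Walks

/-! ### Edge paths and heights -/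

section Heights

variable {V E X : Type*} {G : DirGraph V E} [TopologicalSpace X] [SimplyConnectedSpace X]
  {p : C(X, G.Space)} {c c₁ c₂ : List (E × Bool)} {d : E × Bool} {x y : X}

/-- The half-trees behind the successive edges of a contracted path are nested, so that the end of
the path lies behind its first edge. -/
theorem height_eq_one_of_contracted_cons (hp : IsCoveringMap p) {l : EdgeLift p} {b : Bool}
    (hc : Contracted ((l.base, b) :: c)) (h : LiftsWalk p c (l.path (if b then 1 else 0)) y) :
    l.height hp b y = 1 := by
  rw [contracted_iff_isReduced] at hc
  induction c generalizing l b with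
  | nil => obtain rfl : _ = y := h; exact EdgeLift.height_end hp l b
  | cons d c ih =>
    obtain ⟨l', h1, h2, h3⟩ := liftsWalk_cons.1 h
    obtain ⟨e', b'⟩ := d
    subst h1
    dsimp only at h2 h3
    rw [FreeGroup.isReduced_cons_cons] at hc
    have hy := ih hc.2 h3
    have hl : l ≠ l' := by
      rintro rfl
      have hb : b = b' := hc.1 rfl
      subst hb
      have := l.path_injective h2
      cases b <;> simp at this
    have hint : l.height hp b y = 0 ∨ l.height hp b y = 1 := by
      refine EdgeLift.height_eq_zero_or_one hp l b fun t ht => ?_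
      obtain ⟨v, hv⟩ := h3.exists_eq_vert (l'.proj_end b')
      exact G.eq_zero_or_one_of_edge_eq_vert (by rw [← l.proj, ht, hv])
    refine hint.resolve_left fun h0 => ?_
    refine EdgeLift.height_eq_zero_of_height_eq_one hp hl (b := !b) (b' := b')
      (t := if b' then 0 else 1) (t' := if b then 1 else 0) ?_ ?_ (y := y) ?_ hy
    · rw [EdgeLift.height_not, h2, EdgeLift.height_end, sub_self]
    · rw [← h2, EdgeLift.height_start]
    · rw [EdgeLift.height_not, h0, sub_zero]

/-- The two ends of a contracted path lie on different sides of every edge of the path. -/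
theorem height_of_contracted (hp : IsCoveringMap p) {l : EdgeLift p} {b : Bool}
    (hc : Contracted (c₁ ++ (l.base, b) :: c₂))
    (h₁ : LiftsWalk p c₁ x (l.path (if b then 0 else 1)))
    (h₂ : LiftsWalk p c₂ (l.path (if b then 1 else 0)) y) :
    l.height hp b x = 0 ∧ l.height hp b y = 1 := by
  rw [contracted_iff_isReduced] at hc
  constructor
  · have h : l.height hp (!b) x = 1 := by
      refine height_eq_one_of_contracted_cons hp (c := FreeGroup.invRev c₁) ?_ ?_
      · have := isReduced_invRev (hc.infix ⟨[], c₂, by simp⟩ :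
          FreeGroup.IsReduced (c₁ ++ [(l.base, b)]))
        rw [contracted_iff_isReduced]
        simpa [FreeGroup.invRev] using this
      · have := h₁.invRev
        cases b <;> exact this
    rw [EdgeLift.height_not] at h
    linarith
  · exact height_eq_one_of_contracted_cons hp
      (contracted_iff_isReduced.2 (hc.infix ⟨c₁, [], by simp⟩)) h₂

open Classical in
/-- A lift of `e` that separates the ends of a path is one of the edges of the path. -/
theorem LiftsWalk.exists_finset (hp : IsCoveringMap p) (h : LiftsWalk p c x y) (e : E) :
    ∃ S : Finset (EdgeLift p), S.card ≤ c.countP (fun d => d.1 = e) ∧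
      ∀ l ∉ S, l.base = e → ∀ b, l.height hp b x = l.height hp b y := by
  induction c generalizing x with
  | nil => exact ⟨∅, by simp, fun l _ _ b => by rw [show x = y from h]⟩
  | cons d c ih =>
    obtain ⟨l', h1, rfl, h3⟩ := liftsWalk_cons.1 h
    obtain ⟨S, hS, hS'⟩ := ih h3
    by_cases hd : d.1 = e
    · refine ⟨insert l' S, (Finset.card_insert_le _ _).trans (by simpa [hd] using hS), ?_⟩
      intro l hl he b
      rw [Finset.mem_insert, not_or] at hl
      rw [← hS' l hl.2 he, EdgeLift.height_path_eq_of_ne hp hl.1]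
    · refine ⟨S, by simpa [hd] using hS, fun l hl he b => ?_⟩
      have hne : l ≠ l' := by
        rintro rfl
        exact hd (h1.symm.trans he)
      rw [← hS' l hl he, EdgeLift.height_path_eq_of_ne hp hne]

end Heights

/-! ### Covering transformations -/

section DeckGroup

variable {V E X : Type*} {G : DirGraph V E} [TopologicalSpace X] {p : C(X, G.Space)}

theorem deck_ext [PreconnectedSpace X] (hp : IsCoveringMap p) {g h : Deck p} (x : X)
    (hx : g.1 x = h.1 x) : g = h := by
  refine Subtype.ext (Homeomorph.ext (congrFun ?_))
  exact hp.eq_of_comp_eq g.1.continuous h.1.continuous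
    (funext fun y => (g.2 y).trans (h.2 y).symm) x hx

theorem inv_apply_apply (g : Deck p) (x : X) : (g⁻¹).1 (g.1 x) = x := g.1.symm_apply_apply x

theorem apply_inv_apply (g : Deck p) (x : X) : g.1 ((g⁻¹).1 x) = x := g.1.apply_symm_apply x

theorem mul_apply (g h : Deck p) (x : X) : (g * h).1 x = g.1 (h.1 x) := rfl

theorem IsHomotopyLift.apply_eq {f : C(G.Space, G.Space)} {F : C(X, X)}
    (hF : IsHomotopyLift p f F) (x : X) : p (F x) = f (p x) := by
  obtain ⟨H, K, h⟩ := hF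
  simpa using h 1 x

/-- For a covering transformation `g`, the paths traced by `g x` and by `x`, moved by `g`, during
the lifted homotopy are lifts of the same path. -/
theorem IsHomotopyLift.map_deck (hp : IsCoveringMap p) {f : C(G.Space, G.Space)} {F : C(X, X)}
    (hF : IsHomotopyLift p f F) (g : Deck p) (x : X) : F (g.1 x) = g.1 (F x) := by
  obtain ⟨H, K, h⟩ := hF
  have hg : Continuous fun y => g.1 y := g.1.continuous
  have key := hp.eq_of_comp_eq (g₁ := fun t : unitInterval => K (t, g.1 x))
    (g₂ := fun t : unitInterval => g.1 (K (t, x))) (by fun_prop) (by fun_prop)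
    (funext fun t => (h t _).trans ((congrArg (fun y => H (t, y)) (g.2 x)).trans
      ((h t x).symm.trans (g.2 _).symm))) 0 (by simp)
  simpa using congrFun key 1

theorem IsHomotopyLift.iterate_map_deck (hp : IsCoveringMap p) {f : C(G.Space, G.Space)}
    {F : C(X, X)} (hF : IsHomotopyLift p f F) (g : Deck p) (x : X) (k : ℕ) :
    F^[k] (g.1 x) = g.1 (F^[k] x) := by
  induction k generalizing x with
  | zero => rfl
  | succ k ih => rw [Function.iterate_succ_apply, hF.map_deck hp, ih, Function.iterate_succ_apply]

theorem IsHomotopyLift.iterate_mul (hp : IsCoveringMap p) {f : C(G.Space, G.Space)}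
    {F : C(X, X)} (hF : IsHomotopyLift p f F) {w : Deck p} {x : X} {m : ℕ}
    (h : F^[m] x = w.1 x) (k : ℕ) : F^[m * k] x = (w ^ k).1 x := by
  induction k with
  | zero => rfl
  | succ k ih =>
    rw [Nat.mul_succ, Function.iterate_add_apply, h, hF.iterate_map_deck hp, ih, pow_succ',
      mul_apply]

theorem IsHomotopyLift.iterate_apply_eq {f : C(G.Space, G.Space)} {F : C(X, X)}
    (hF : IsHomotopyLift p f F) (x : X) (k : ℕ) : p (F^[k] x) = f^[k] (p x) := by
  induction k generalizing x with
  | zero => rfl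
  | succ k ih => rw [Function.iterate_succ_apply, ih, hF.apply_eq, Function.iterate_succ_apply]

end DeckGroup

/-! ### Words of edge paths -/

section SpanningTree

variable {V E : Type*} {G : DirGraph V E} {T : Set E} {u v w : V} {c c₁ c₂ : List (E × Bool)}

theorem isWalk_append :
    G.IsWalk u w (c₁ ++ c₂) ↔ ∃ v, G.IsWalk u v c₁ ∧ G.IsWalk v w c₂ := by
  induction c₁ generalizing u with
  | nil => exact ⟨fun h => ⟨u, rfl, h⟩, fun ⟨y, h, h'⟩ => by obtain rfl : u = y := h; exact h'⟩
  | cons d c ih =>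
    exact ⟨fun ⟨h1, h2⟩ => let ⟨v, h3, h4⟩ := ih.1 h2; ⟨v, ⟨h1, h3⟩, h4⟩,
      fun ⟨v, ⟨h1, h2⟩, h3⟩ => ⟨h1, ih.2 ⟨v, h2, h3⟩⟩⟩

open Classical in
/-- The word of an edge path: the sequence of its edges outside of `T`. -/
noncomputable def word (T : Set E) (c : List (E × Bool)) : List ({e : E // e ∉ T} × Bool) :=
  c.filterMap fun d => if h : d.1 ∈ T then none else some (⟨d.1, h⟩, d.2)

theorem word_append : word T (c₁ ++ c₂) = word T c₁ ++ word T c₂ := List.filterMap_append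

theorem word_cons_of_mem {d : E × Bool} (h : d.1 ∈ T) : word T (d :: c) = word T c := by
  simp [word, h]

theorem word_cons_of_notMem {d : E × Bool} (h : d.1 ∉ T) :
    word T (d :: c) = (⟨d.1, h⟩, d.2) :: word T c := by
  simp [word, h]

theorem exists_append_of_mem_head?_word {y : {e : E // e ∉ T} × Bool}
    (hy : y ∈ (word T c).head?) :
    ∃ c₁ c₂, c = c₁ ++ (y.1.1, y.2) :: c₂ ∧ ∀ d ∈ c₁, d.1 ∈ T := by
  induction c with
  | nil => simp [word] at hy
  | cons d c ih =>
    by_cases hd : d.1 ∈ T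
    · rw [word_cons_of_mem hd] at hy
      obtain ⟨c₁, c₂, rfl, h⟩ := ih hy
      exact ⟨d :: c₁, c₂, rfl, by simpa [hd] using h⟩
    · rw [word_cons_of_notMem hd] at hy
      obtain rfl : _ = y := by simpa using hy
      exact ⟨[], c, rfl, by simp⟩

/-- Between an edge outside of the spanning tree and its reverse a contracted path would contain a
closed contracted path in the tree. -/
theorem isReduced_word (hT : G.IsSpanningTree T) (hc : Contracted c) (hw : G.IsWalk u v c) :
    FreeGroup.IsReduced (word T c) := by
  rw [contracted_iff_isReduced] at hc
  induction c generalizing u with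
  | nil => simp [word]
  | cons d c ih =>
    have hred := ih (hc.infix ⟨[d], [], by simp⟩) hw.2
    by_cases hd : d.1 ∈ T
    · rwa [word_cons_of_mem hd]
    rw [word_cons_of_notMem hd, FreeGroup.IsReduced, List.isChain_cons]
    refine ⟨fun y hy hdy => ?_, hred⟩
    obtain ⟨c₁, c₂, rfl, hc₁⟩ := exists_append_of_mem_head?_word hy
    obtain ⟨⟨e', he'⟩, b'⟩ := y
    obtain ⟨e, b⟩ := d
    obtain rfl : e = e' := congrArg Subtype.val hdy
    dsimp only at hw hc ⊢
    by_contra hb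
    obtain rfl : b' = !b := by cases b <;> cases b' <;> simp_all
    obtain ⟨w, hw₁, hw₂⟩ := isWalk_append.1 hw.2
    obtain rfl : w = G.dartTgt (e, b) := by
      rw [← hw₂.1]
      cases b <;> rfl
    have hnil : c₁ = [] := (hT _ _).unique
      ⟨hw₁, contracted_iff_isReduced.2 (hc.infix ⟨[(e, b)], (e, !b) :: c₂, by simp⟩), hc₁⟩
      ⟨rfl, List.isChain_nil, by simp⟩
    subst hnil
    rw [List.nil_append, FreeGroup.isReduced_cons_cons] at hc
    exact hb (hc.1 rfl)

end SpanningTree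

namespace CoherentLabeling

variable {V E X : Type*} {G : DirGraph V E} [TopologicalSpace X] {p : C(X, G.Space)} {T : Set E}
  (L : CoherentLabeling p T)

/-- The chosen lift of an edge. -/
def edgeLift (e : E) : EdgeLift p := ⟨e, L.eLift e, L.p_eLift e⟩

theorem θ_eq_one [PreconnectedSpace X] (hp : IsCoveringMap p) {e : E} (he : e ∈ T) : L.θ e = 1 :=
  deck_ext hp (L.vLift (G.tgt e)) ((L.eLift_one e).symm.trans (L.eLift_one_of_mem e he))

theorem eq_translate_of_start (hp : IsCoveringMap p) {l : EdgeLift p} {g : Deck p}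
    (h : l.path 0 = g.1 (L.vLift (G.src l.base))) : l = (L.edgeLift l.base).translate g :=
  EdgeLift.eq_of_path_eq hp rfl (t := 0) (h.trans (congrArg g.1 (L.eLift_zero l.base).symm))

theorem eq_translate_of_end (hp : IsCoveringMap p) {l : EdgeLift p} {g : Deck p}
    (h : l.path 1 = g.1 (L.vLift (G.tgt l.base))) :
    l = (L.edgeLift l.base).translate (g * (L.θ l.base)⁻¹) := by
  refine EdgeLift.eq_of_path_eq hp rfl (t := 1) (h.trans ?_)
  change _ = g.1 (((L.θ l.base)⁻¹).1 (L.eLift l.base 1))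
  rw [L.eLift_one, inv_apply_apply]

/-- The end of a lifted edge path is determined by the word of the path. -/
theorem end_eq [PreconnectedSpace X] (hp : IsCoveringMap p) {c : List (E × Bool)} {u v : V}
    {g : Deck p} {y : X} (hc : LiftsWalk p c (g.1 (L.vLift u)) y) (hw : G.IsWalk u v c) :
    y = (g * L.ofWord (FreeGroup.mk (word T c))).1 (L.vLift v) := by
  induction c generalizing u g with
  | nil =>
    obtain rfl : u = v := hw
    obtain rfl : _ = y := hc
    rw [show word T [] = [] from rfl, ← FreeGroup.one_eq_mk, map_one, mul_one]
  | cons d c ih =>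
    obtain ⟨l, h1, h2, h3⟩ := liftsWalk_cons.1 hc
    obtain ⟨e, b⟩ := d
    subst h1
    obtain ⟨rfl, hw⟩ := hw
    have hend : l.path (if b then 1 else 0) =
        (g * cond b (L.θ l.base) (L.θ l.base)⁻¹).1 (L.vLift (G.dartTgt (l.base, b))) := by
      cases b
      · rw [L.eq_translate_of_end hp h2]
        exact congrArg (g * (L.θ l.base)⁻¹).1 (L.eLift_zero l.base)
      · rw [L.eq_translate_of_start hp h2]
        exact congrArg g.1 (L.eLift_one l.base)
    rw [hend] at h3
    rw [ih h3 hw, mul_assoc]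
    congr 3
    by_cases he : l.base ∈ T
    · rw [word_cons_of_mem he, L.θ_eq_one hp he]
      cases b <;> simp
    · rw [word_cons_of_notMem he]
      cases b <;> simp [ofWord]

end CoherentLabeling

/-! ### Translates of an edge that separate the iterated images of two vertices -/

section Separation

variable {V E X : Type*} {G : DirGraph V E} [TopologicalSpace X] [SimplyConnectedSpace X]
  {p : C(X, G.Space)}

open Classical in
/-- A loop for `w` that avoids `e` can be repeated without crossing any further lifts of `e`. So
the number of lifts of `e` that separate `x` from `w ^ k y` is bounded independently of `k`. -/
theorem exists_bound_of_not_belongs (hp : IsCoveringMap p) {e : E} {w : Deck p}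
    (hw : ¬ Belongs p e w) {x y : X} {u v : V} (hx : p x = G.vert u) (hy : p y = G.vert v) :
    ∃ B : ℕ, ∀ k : ℕ, ∃ S : Finset (EdgeLift p), S.card ≤ B ∧
      ∀ l ∉ S, l.base = e → ∀ b, l.height hp b x = l.height hp b ((w ^ k).1 y) := by
  obtain ⟨C, z, hz, ⟨v', hv'⟩, hC⟩ : ∃ C z, LiftsWalk p C z (w.1 z) ∧ (∃ v, p z = G.vert v) ∧
      ∀ d ∈ C, d.1 ≠ e := by
    simp only [Belongs, not_forall, not_exists, not_and] at hw
    obtain ⟨C, ⟨-, -, z, hz⟩, hC⟩ := hw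
    cases C with
    | nil =>
      obtain rfl : w = 1 := deck_ext hp z (Eq.symm hz)
      exact ⟨[], y, rfl, ⟨v, hy⟩, by simp⟩
    | cons d C =>
      obtain ⟨l, h1, h2, h3⟩ := liftsWalk_cons.1 hz
      exact ⟨_, z, hz, ⟨_, h2 ▸ l.proj_start d.2⟩, hC⟩
  obtain ⟨R, hR⟩ := exists_liftsWalk hp hx hv'
  obtain ⟨Q, hQ⟩ := exists_liftsWalk hp hv' hy
  refine ⟨R.length + Q.length, fun k => ?_⟩
  obtain ⟨S, hS, hS'⟩ := LiftsWalk.exists_finset hp (liftsWalk_append.2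
    ⟨_, hR, liftsWalk_append.2 ⟨_, hz.pow k, hQ.translate (w ^ k)⟩⟩) e
  refine ⟨S, hS.trans ?_, hS'⟩
  have h0 : (List.replicate k C).flatten.countP (fun d => d.1 = e) = 0 := by
    rw [List.countP_eq_zero]
    intro d hd
    obtain ⟨C', hC', hd⟩ := List.mem_flatten.1 hd
    rw [List.eq_of_mem_replicate hC'] at hd
    simpa using hC d hd
  rw [List.countP_append, List.countP_append, h0]
  have h1 := List.countP_le_length (l := R) (p := fun d => decide (d.1 = e))
  have h2 := List.countP_le_length (l := Q) (p := fun d => decide (d.1 = e))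
  omega

/-- On a contracted path from `x` to `w x` there is a lift of `e` which separates `w ^ k x` for
positive `k` from `w ^ k x` for `k ≤ 0`, provided that `e` belongs to `w`: the axis of `w` passes
through it. -/
theorem exists_separating_powers (hp : IsCoveringMap p) {e : E} {w : Deck p} (hw : Belongs p e w)
    {P : List (E × Bool)} (hPc : Contracted P) {x : X} {u : V} (hx : p x = G.vert u)
    (hP : LiftsWalk p P x (w.1 x)) :
    ∃ (c₁ c₂ : List (E × Bool)) (l : EdgeLift p) (b : Bool), P = c₁ ++ (e, b) :: c₂ ∧ l.base = e ∧
      LiftsWalk p c₁ x (l.path (if b then 0 else 1)) ∧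
      ∀ j k : ℕ, l.height hp b (((w ^ j)⁻¹).1 x) = 0 ∧ l.height hp b ((w ^ (k + 1)).1 x) = 1 := by
  classical
  rw [contracted_iff_isReduced] at hPc
  have hC := FreeGroup.reduceCyclically.isCyclicallyReduced hPc
  have hPeq := FreeGroup.reduceCyclically.conj_conjugator_reduceCyclically P
  generalize FreeGroup.reduceCyclically P = C at hC hPeq
  generalize FreeGroup.reduceCyclically.conjugator P = U at hPeq
  subst hPeq
  obtain ⟨z', h, hU'⟩ := liftsWalk_append.1 hP
  obtain ⟨z, hU, hz⟩ := liftsWalk_append.1 h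
  have hz' : z' = w.1 z := by
    have := hU'.invRev
    rw [FreeGroup.invRev_invRev] at this
    exact this.right_unique hp (hU.translate w)
  subst hz'
  obtain ⟨v, hv⟩ := hU.exists_eq_vert hx
  obtain ⟨⟨e', b⟩, hd, rfl⟩ := hw C ⟨⟨v, hz.isWalk hv ((w.2 z).trans hv)⟩,
    cyclicallyReduced_iff_isCyclicallyReduced.2 hC, z, hz⟩
  obtain ⟨C₁, C₂, rfl⟩ := List.append_of_mem hd
  obtain ⟨y, hC₁, hy⟩ := liftsWalk_append.1 hz
  obtain ⟨l, h1, rfl, hC₂⟩ := liftsWalk_cons.1 hy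
  dsimp only at h1 hC₁ hC₂
  subst h1
  refine ⟨U ++ C₁, C₂ ++ FreeGroup.invRev U, l, b, by simp, rfl, liftsWalk_append.2 ⟨z, hU, hC₁⟩,
    fun j k => ?_⟩
  have hred := FreeGroup.IsReduced.append_flatten_replicate_append hC hPc (n := j + 1 + k)
    (by omega)
  rw [List.replicate_add, List.replicate_add, List.flatten_append, List.flatten_append] at hred
  refine height_of_contracted hp
    (c₁ := U ++ ((List.replicate j (C₁ ++ (l.base, b) :: C₂)).flatten ++ C₁))
    (c₂ := C₂ ++ ((List.replicate k (C₁ ++ (l.base, b) :: C₂)).flatten ++ FreeGroup.invRev U))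
    (contracted_iff_isReduced.2 (by simpa using hred)) ?_ ?_
  · refine liftsWalk_append.2 ⟨_, hU.translate _, liftsWalk_append.2 ⟨z, ?_, hC₁⟩⟩
    have := (hz.pow j).translate (w ^ j)⁻¹
    rwa [inv_apply_apply] at this
  · refine liftsWalk_append.2 ⟨_, hC₂, liftsWalk_append.2 ⟨_, (hz.pow k).translate w, ?_⟩⟩
    rw [pow_succ', mul_apply]
    exact (hU.invRev.translate (w ^ k)).translate w

/-- If `e` belongs to `w₁` but not to `w₂`, then some lift `l` of `e` on a contracted path from `x₁`
to `w₁ x₁` has the property that its translate by `w₁ ^ a` separates `w₁ ^ k x₁`, `k > a`, from all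
`w₂ ^ j x₂`, as soon as `a` is large. Otherwise the translates of `l` by `w₁ ^ i`, `i ≤ a`, whose
sides are nested, would all separate `x₁` from `w₂ ^ j x₂`. -/
theorem exists_separating_translates (hp : IsCoveringMap p) {e : E} {w₁ w₂ : Deck p}
    (hw₁ : Belongs p e w₁) (hw₂ : ¬ Belongs p e w₂) {P : List (E × Bool)} (hPc : Contracted P)
    {x₁ x₂ : X} {u₁ u₂ : V} (hx₁ : p x₁ = G.vert u₁) (hx₂ : p x₂ = G.vert u₂)
    (hP : LiftsWalk p P x₁ (w₁.1 x₁)) :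
    ∃ (c₁ c₂ : List (E × Bool)) (l : EdgeLift p) (b : Bool), P = c₁ ++ (e, b) :: c₂ ∧ l.base = e ∧
      LiftsWalk p c₁ x₁ (l.path (if b then 0 else 1)) ∧
      ∃ B : ℕ, ∀ a k j : ℕ, B ≤ a → a < k →
        (l.translate (w₁ ^ a)).height hp b ((w₁ ^ k).1 x₁) = 1 ∧
        (l.translate (w₁ ^ a)).height hp b ((w₂ ^ j).1 x₂) = 0 := by
  obtain ⟨c₁, c₂, l, b, hPeq, hl, hc₁, hsep⟩ := exists_separating_powers hp hw₁ hPc hx₁ hP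
  obtain ⟨B, hB⟩ := exists_bound_of_not_belongs hp hw₂ hx₁ hx₂
  have hpos {i k : ℕ} (h : i < k) :
      (l.translate (w₁ ^ i)).height hp b ((w₁ ^ k).1 x₁) = 1 := by
    obtain ⟨k, rfl⟩ := Nat.exists_eq_add_of_lt h
    rw [EdgeLift.height_translate', ← mul_apply, add_assoc, pow_add, inv_mul_cancel_left]
    exact (hsep 0 k).2
  have hneg {i k : ℕ} (h : k ≤ i) :
      (l.translate (w₁ ^ i)).height hp b ((w₁ ^ k).1 x₁) = 0 := by
    obtain ⟨i, rfl⟩ := Nat.exists_eq_add_of_le h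
    rw [EdgeLift.height_translate', ← mul_apply, pow_add, mul_inv_rev, inv_mul_cancel_right]
    exact (hsep i 0).1
  have hne {i a : ℕ} (h : i < a) : l.translate (w₁ ^ i) ≠ l.translate (w₁ ^ a) := by
    intro heq
    have h1 := hpos (Nat.lt_succ_self i)
    rw [heq, hneg (Nat.succ_le_of_lt h)] at h1
    exact zero_ne_one h1
  refine ⟨c₁, c₂, l, b, hPeq, hl, hc₁, B, fun a k j hBa hak => ⟨hpos hak, ?_⟩⟩
  have hvert : p ((w₂ ^ j).1 x₂) = G.vert u₂ := ((w₂ ^ j).2 x₂).trans hx₂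
  refine (EdgeLift.height_eq_zero_or_one hp (l.translate (w₁ ^ a)) b fun t ht => ?_).resolve_right
    fun h1 => ?_
  · exact G.eq_zero_or_one_of_edge_eq_vert ((EdgeLift.proj _ t).symm.trans (ht ▸ hvert))
  have hall (i : ℕ) (hi : i ≤ a) :
      (l.translate (w₁ ^ i)).height hp b ((w₂ ^ j).1 x₂) = 1 := by
    rcases hi.eq_or_lt with rfl | hi
    · exact h1
    refine (EdgeLift.height_eq_zero_or_one hp (l.translate (w₁ ^ i)) b
      fun t ht => ?_).resolve_left fun h0 => ?_
    · exact G.eq_zero_or_one_of_edge_eq_vert ((EdgeLift.proj _ t).symm.trans (ht ▸ hvert))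
    exact EdgeLift.exists_quadrant_eq_empty hp (hne hi) b b (hneg i.zero_le) (hneg a.zero_le) h0 h1
      (hpos (Nat.lt_succ_self i)) (hneg (Nat.succ_le_of_lt hi))
      (hpos (hi.trans (Nat.lt_succ_self a))) (hpos (Nat.lt_succ_self a))
  obtain ⟨S, hS, hS'⟩ := hB j
  have hcard := Finset.card_le_card_of_injOn (s := Finset.range (a + 1)) (t := S)
    (fun i => l.translate (w₁ ^ i)) ?_ ?_
  · rw [Finset.card_range] at hcard
    omega
  · intro i hi
    have hi : i ≤ a := Nat.lt_succ_iff.1 (Finset.mem_range.1 hi)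
    by_contra hmem
    have h2 := hS' _ hmem hl b
    rw [hall i hi] at h2
    have h3 := hneg (k := 0) i.zero_le
    rw [pow_zero] at h3
    exact zero_ne_one (h3.symm.trans h2)
  · intro i _ i' _ hii
    by_contra hcon
    rcases lt_or_gt_of_ne hcon with h | h
    · exact hne h hii
    · exact hne h hii.symm

end Separation

/-! ### Periodic points in an edge -/

namespace CoherentLabeling

variable {V E X : Type*} {G : DirGraph V E} [TopologicalSpace X]
  {p : C(X, G.Space)} {T : Set E} (L : CoherentLabeling p T)

theorem iterate_eq_of_hasRotationElement_vert {f : C(G.Space, G.Space)} {F : C(X, X)} {v : V}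
    {w : Deck p} {n : ℕ} (h : L.HasRotationElement f F (G.vert v) w n) :
    0 < n ∧ F^[n] (L.vLift v) = w.1 (L.vLift v) := by
  obtain ⟨hn, -, y, ⟨v', hv', rfl⟩ | ⟨e, t, h0, h1, he, -⟩, hy⟩ := h
  · obtain rfl := G.vert_injective hv'
    exact ⟨hn, hy⟩
  · rcases G.eq_zero_or_one_of_edge_eq_vert he.symm with rfl | rfl
    · exact (lt_irrefl _ h0).elim
    · exact (lt_irrefl _ h1).elim

theorem isChosenLift_edge {e : E} (he : e ∈ T) (t : unitInterval) :
    L.IsChosenLift (G.edge e t) (L.eLift e t) := by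
  by_cases h0 : t = 0
  · exact Or.inl ⟨G.src e, by rw [h0, edge_zero], by rw [h0, L.eLift_zero]⟩
  by_cases h1 : t = 1
  · exact Or.inl ⟨G.tgt e, by rw [h1, edge_one], by rw [h1, L.eLift_one_of_mem e he]⟩
  exact Or.inr ⟨e, t, unitInterval.pos_iff_ne_zero.2 h0, unitInterval.lt_one_iff_ne_one.2 h1, rfl,
    rfl⟩

variable [SimplyConnectedSpace X]

/-- A lift which a lifted edge path traverses is the translate of the chosen one by the element
represented by the word of the preceding part of the path. -/
theorem eq_translate_ofWord (hp : IsCoveringMap p) {l : EdgeLift p} (hl : l.base ∈ T) {b : Bool}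
    {u : V} {c : List (E × Bool)}
    (hc : LiftsWalk p c (L.vLift u) (l.path (if b then 0 else 1))) :
    l = (L.edgeLift l.base).translate (L.ofWord (FreeGroup.mk (word T c))) := by
  have h := L.end_eq hp (g := 1) hc (hc.isWalk (L.p_vLift u) (l.proj_start b))
  rw [one_mul] at h
  cases b
  · have := L.eq_translate_of_end hp h
    rwa [L.θ_eq_one hp hl, inv_one, mul_one] at this
  · exact L.eq_translate_of_start hp h

theorem exists_initialSubword_separating (hp : IsCoveringMap p) (hT : G.IsSpanningTree T) {e : E}
    (he : e ∈ T) {w₁ w₂ : Deck p} (hw₁ : Belongs p e w₁) (hw₂ : ¬ Belongs p e w₂) (u₁ u₂ : V) :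
    ∃ γ : Deck p, L.IsInitialSubword γ w₁ ∧ ∃ (b : Bool) (B : ℕ), ∀ a k j : ℕ, B ≤ a → a < k →
      ((L.edgeLift e).translate (w₁ ^ a * γ)).height hp b ((w₁ ^ k).1 (L.vLift u₁)) = 1 ∧
      ((L.edgeLift e).translate (w₁ ^ a * γ)).height hp b ((w₂ ^ j).1 (L.vLift u₂)) = 0 := by
  have hv₁ := L.p_vLift u₁
  have hv₁' := (w₁.2 _).trans hv₁
  obtain ⟨P₀, hP₀⟩ := exists_liftsWalk hp hv₁ hv₁'
  obtain ⟨P, hPc, hP⟩ := hP₀.exists_contracted hp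
  have hw := hP.isWalk hv₁ hv₁'
  obtain ⟨c₁, c₂, l, b, rfl, rfl, hc₁, B, hB⟩ :=
    exists_separating_translates hp hw₁ hw₂ hPc hv₁ (L.p_vLift u₂) hP
  refine ⟨L.ofWord (FreeGroup.mk (word T c₁)),
    ⟨word T c₁, _, isReduced_word hT hPc hw, ?_, ?_, rfl⟩, b, B, fun a k j ha hk => ?_⟩
  · rw [word_append]
    exact List.prefix_append _ _
  · have := L.end_eq hp (g := 1) hP hw
    rw [one_mul] at this
    exact (deck_ext hp _ this).symm
  · have := hB a k j ha hk
    rw [L.eq_translate_ofWord hp he hc₁] at this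
    exact this

/-- One of the two symmetric assertions: the vertices `u₁` and `u₂` are the ends of the edge `e`, in
any order, and `t₁` and `t₂` are their coordinates. -/
theorem exists_initialSubword_periodicPoints (hp : IsCoveringMap p) {f : C(G.Space, G.Space)}
    {F : C(X, X)} (hF : IsHomotopyLift p f F) (hT : G.IsSpanningTree T) {e : E} (he : e ∈ T)
    {m n : ℕ} (hm : 0 < m) (hn : 0 < n) {w₁ w₂ : Deck p} {u₁ u₂ : V} {t₁ t₂ : unitInterval}
    (ht : t₁ = 0 ∧ t₂ = 1 ∨ t₁ = 1 ∧ t₂ = 0)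
    (hu₁ : L.eLift e t₁ = L.vLift u₁) (hu₂ : L.eLift e t₂ = L.vLift u₂)
    (h₁ : F^[m] (L.vLift u₁) = w₁.1 (L.vLift u₁)) (h₂ : F^[n] (L.vLift u₂) = w₂.1 (L.vLift u₂))
    (hw₁ : Belongs p e w₁) (hw₂ : ¬ Belongs p e w₂) :
    ∃ γ : Deck p, L.IsInitialSubword γ w₁ ∧ ∀ r : ℚ, 0 < r → r < 1 / (m : ℚ) →
      ∃ a b : ℕ, 0 < b ∧ r = (a : ℚ) / (b : ℚ) ∧
        ∃ x ∈ Set.range (G.edge e), L.HasRotationElement f F x (w₁ ^ a * γ) b := by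
  obtain ⟨γ, hγ, b, B, hB⟩ := L.exists_initialSubword_separating hp hT he hw₁ hw₂ u₁ u₂
  refine ⟨γ, hγ, fun r hr hrm => ?_⟩
  obtain ⟨s, hs⟩ : ∃ s : ℕ, r.num = s := ⟨_, (Int.toNat_of_nonneg (Rat.num_pos.2 hr).le).symm⟩
  have hs0 : 0 < s := by
    have := Rat.num_pos.2 hr
    omega
  have hrs : r = (s : ℚ) / (r.den : ℚ) := by
    conv_lhs => rw [← Rat.num_div_den r, hs]
    simp
  have hden : 0 < r.den := r.den_pos
  have hsm : s * m < r.den := by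
    rw [hrs, div_lt_div_iff₀ (by exact_mod_cast hden) (by exact_mod_cast hm)] at hrm
    have : ((s * m : ℕ) : ℚ) < r.den := by push_cast; linarith
    exact_mod_cast this
  -- a common multiple of the periods and of the denominator, large enough for the bound `B`
  set N := n * (B + 1) with hN
  have hN0 : 0 < N := Nat.mul_pos hn B.succ_pos
  set a := s * m * N with ha
  set q := m * (r.den * N) with hq
  have hq0 : 0 < q := Nat.mul_pos hm (Nat.mul_pos hden hN0)
  have hBa : B ≤ a := by
    have h1 : 1 ≤ s * m * n := Nat.mul_pos (Nat.mul_pos hs0 hm) hn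
    have h2 : a = s * m * n * (B + 1) := by rw [ha, hN]; ring
    rw [h2]
    nlinarith
  have hak : a < r.den * N := Nat.mul_lt_mul_of_pos_right hsm hN0
  refine ⟨a, q, hq0, ?_, ?_⟩
  · have h1 : (r.den : ℚ) ≠ 0 := by exact_mod_cast hden.ne'
    have h2 : (N : ℚ) ≠ 0 := by exact_mod_cast hN0.ne'
    have h3 : (m : ℚ) ≠ 0 := by exact_mod_cast hm.ne'
    conv_lhs => rw [hrs]
    rw [ha, hq]
    push_cast
    field_simp
  set g : Deck p := w₁ ^ a * γ with hg
  have hk₁ := hF.iterate_mul hp h₁ (r.den * N)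
  have hk₂ := hF.iterate_mul hp h₂ (m * r.den * (B + 1))
  rw [show n * (m * r.den * (B + 1)) = q by rw [hq, hN]; ring] at hk₂
  rw [← hq] at hk₁
  obtain ⟨hs₁, hs₂⟩ := hB a (r.den * N) (m * r.den * (B + 1)) hBa hak
  rw [← hk₁, ← hu₁, EdgeLift.height_translate'] at hs₁
  rw [← hk₂, ← hu₂, EdgeLift.height_translate'] at hs₂
  let φ : C(X, X) := ⟨fun y => (g⁻¹).1 (F^[q] y),
    (g⁻¹).1.continuous.comp (F.continuous.iterate q)⟩
  obtain ⟨t, ht⟩ : ∃ t, φ ((L.edgeLift e).path t) = (L.edgeLift e).path t := by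
    rcases ht with ⟨rfl, rfl⟩ | ⟨rfl, rfl⟩
    · refine EdgeLift.exists_fixedPoint hp (L.edgeLift e) φ (b := !b) ?_ ?_
      · rw [EdgeLift.height_not]
        exact (congrArg (1 - ·) hs₁).trans (sub_self 1)
      · rw [EdgeLift.height_not]
        exact (congrArg (1 - ·) hs₂).trans (sub_zero 1)
    · exact EdgeLift.exists_fixedPoint hp (L.edgeLift e) φ hs₂ hs₁
  have htF : F^[q] (L.eLift e t) = g.1 (L.eLift e t) := by
    have := congrArg g.1 ht
    exact (apply_inv_apply g _).symm.trans this
  refine ⟨G.edge e t, ⟨t, rfl⟩, hq0, ?_, _, L.isChosenLift_edge he t, htF⟩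
  rw [← L.p_eLift, ← hF.iterate_apply_eq, htF]
  exact g.2 _

end CoherentLabeling

end DirGraph

theorem mainTheorem6 {V E X : Type*} [Finite V] [Finite E] (G : DirGraph V E)
    [TopologicalSpace X] [SimplyConnectedSpace X]
    (p : C(X, G.Space)) (hp : IsCoveringMap p)
    (f : C(G.Space, G.Space)) (hf : G.IsVertexMap f)
    (F : C(X, X)) (hF : DirGraph.IsHomotopyLift p f F)
    (T : Set E) (hT : G.IsSpanningTree T) (L : DirGraph.CoherentLabeling p T)
    (e : E) (he : e ∈ T) (m n : ℕ) (w₁ w₂ : DirGraph.Deck p)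
    (h₁ : L.HasRotationElement f F (G.vert (G.src e)) w₁ m)
    (h₂ : L.HasRotationElement f F (G.vert (G.tgt e)) w₂ n) :
    (DirGraph.Belongs p e w₁ → ¬ DirGraph.Belongs p e w₂ →
      ∃ γ₁ : DirGraph.Deck p, L.IsInitialSubword γ₁ w₁ ∧
        ∀ r : ℚ, 0 < r → r < 1 / (m : ℚ) →
          ∃ a b : ℕ, 0 < b ∧ r = (a : ℚ) / (b : ℚ) ∧
            ∃ x ∈ Set.range (G.edge e), L.HasRotationElement f F x (w₁ ^ a * γ₁) b) ∧
    (DirGraph.Belongs p e w₂ → ¬ DirGraph.Belongs p e w₁ →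
      ∃ γ₂ : DirGraph.Deck p, L.IsInitialSubword γ₂ w₂ ∧
        ∀ s : ℚ, 0 < s → s < 1 / (n : ℚ) →
          ∃ a b : ℕ, 0 < b ∧ s = (a : ℚ) / (b : ℚ) ∧
            ∃ x ∈ Set.range (G.edge e), L.HasRotationElement f F x (w₂ ^ a * γ₂) b) := by
  obtain ⟨hm, hx₁⟩ := L.iterate_eq_of_hasRotationElement_vert h₁
  obtain ⟨hn, hx₂⟩ := L.iterate_eq_of_hasRotationElement_vert h₂
  exact ⟨L.exists_initialSubword_periodicPoints hp hF hT he hm hn (Or.inl ⟨rfl, rfl⟩)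
      (L.eLift_zero e) (L.eLift_one_of_mem e he) hx₁ hx₂,
    L.exists_initialSubword_periodicPoints hp hF hT he hn hm (Or.inr ⟨rfl, rfl⟩)
      (L.eLift_one_of_mem e he) (L.eLift_zero e) hx₂ hx₁⟩
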